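/- Let $X$ be a real or complex Banach space, identified with its canonical image in the bidual $X^{**}$, and let $(x_k)$ be a bounded sequence in $X$. Let $\operatorname{clust}(x_k)$ be the set of all weak* cluster points of $(x_k)$ in $X^{**}$, let $\delta_X(x_k)$ be the norm diameter of $\operatorname{clust}(x_k)$, and let $\widetilde\delta(x_k)=\inf\{\delta_X(x_{k_j}) : (x_{k_j}) \text{ a subsequence of } (x_k)\}$. For nonempty $A,B\subset X^{**}$ put $\operatorname{d}(A,B)=\inf\{\|a-b\|: a\in A,\ b\in B\}$ and $\widehat{\operatorname{d}}(A,B)=\sup\{\operatorname{d}(\{a\},B): a\in A\}$. Then $$\widetilde\delta(x_k)\le 2\,\widehat{\operatorname{d}}(\operatorname{clust}(x_k),X).$$ If moreover $X$ is $L$-embedded, i.e. there is a linear projection $P$ of $X^{**}$ onto $X$ with $\|x^{**}\|=\|Px^{**}\|+\|x^{**}-Px^{**}\|$ for all $x^{**}\in X^{**}$, then also $$2\,\widehat{\operatorname{d}}(\operatorname{clust}(x_k),X)\le\delta_X(x_k)\quad\text{and}\quad 2\operatorname{d}(\operatorname{clust}(x_k),X)\le\widetilde\delta(x_k).$$ The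 factor $2$ is optimal in all three inequalities: the (real or complex) space $\ell_1$ is $L$-embedded, and for the bounded sequence $(e_k)$ of its canonical unit vectors $\widehat{\operatorname{d}}(\operatorname{clust}(e_k),\ell_1)=\operatorname{d}(\operatorname{clust}(e_k),\ell_1)=1$ and $\widetilde\delta(e_k)=\delta_{\ell_1}(e_k)=2$. -/

import Mathlib

noncomputable section

/-- The set of all weak* cluster points in the bidual `X**` of a sequence `x` in `X`, where `X` is
regarded as a subspace of `X**` through the canonical embedding. -/
def clust (𝕜 : Type*) [RCLike 𝕜] {X : Type*} [NormedAddCommGroup X] [NormedSpace 𝕜 X]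
    (x : ℕ → X) : Set (StrongDual 𝕜 (StrongDual 𝕜 X)) :=
  {φ | MapClusterPt (StrongDual.toWeakDual φ) Filter.atTop
    (fun k => StrongDual.toWeakDual (NormedSpace.inclusionInDoubleDual 𝕜 X (x k)))}

/-- The canonical copy of `X` in its bidual `X**`. -/
def canonicalCopy (𝕜 : Type*) [RCLike 𝕜] (X : Type*) [NormedAddCommGroup X] [NormedSpace 𝕜 X] :
    Set (StrongDual 𝕜 (StrongDual 𝕜 X)) :=
  Set.range (NormedSpace.inclusionInDoubleDual 𝕜 X)

/-- The usual distance `d(A, B) = inf {‖a - b‖ : a ∈ A, b ∈ B}` of two nonempty sets. -/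
def setDist {E : Type*} [PseudoMetricSpace E] (A B : Set E) : ℝ :=
  sInf (Set.image2 dist A B)

/-- The non-symmetrized Hausdorff distance `sup {d(a, B) : a ∈ A}` from `A` to `B`
(for nonempty sets, with `A` bounded). -/
def hausdorffExcess {E : Type*} [PseudoMetricSpace E] (A B : Set E) : ℝ :=
  sSup ((fun a => Metric.infDist a B) '' A)

/-- `δ_X(x_k)`: the diameter of the set of weak* cluster points of a bounded sequence. -/
def delta (𝕜 : Type*) [RCLike 𝕜] {X : Type*} [NormedAddCommGroup X] [NormedSpace 𝕜 X]
    (x : ℕ → X) : ℝ :=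
  Metric.diam (clust 𝕜 x)

/-- `δ̃(x_k)`: the infimum of `δ_X` over all subsequences of a bounded sequence. -/
def deltaTilde (𝕜 : Type*) [RCLike 𝕜] {X : Type*} [NormedAddCommGroup X] [NormedSpace 𝕜 X]
    (x : ℕ → X) : ℝ :=
  sInf {r : ℝ | ∃ σ : ℕ → ℕ, StrictMono σ ∧ r = delta 𝕜 (x ∘ σ)}

/-- `X` is L-embedded: there is a linear projection `P` of `X**` onto (the canonical copy of) `X`
such that `‖φ‖ = ‖P φ‖ + ‖φ - P φ‖` for all `φ` in `X**`. -/
def IsLEmbedded (𝕜 : Type*) [RCLike 𝕜] (X : Type*) [NormedAddCommGroup X] [NormedSpace 𝕜 X] :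
    Prop :=
  ∃ P : StrongDual 𝕜 (StrongDual 𝕜 X) →ₗ[𝕜] StrongDual 𝕜 (StrongDual 𝕜 X),
    (∀ φ, P (P φ) = P φ) ∧ Set.range P = canonicalCopy 𝕜 X ∧
      ∀ φ, ‖φ‖ = ‖P φ‖ + ‖φ - P φ‖

/-- The sequence `(e_k)` of canonical unit vectors of `ℓ¹`. -/
def unitVec (𝕜 : Type*) [RCLike 𝕜] (k : ℕ) : lp (fun _ : ℕ => 𝕜) 1 :=
  lp.single 1 k (1 : 𝕜)

end

open Filter Topology

/-! ### Weak* cluster points in the bidual -/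

section Clust

variable {𝕜 : Type*} [RCLike 𝕜] {X : Type*} [NormedAddCommGroup X] [NormedSpace 𝕜 X]

/-! Diameters of cluster sets are read off as oscillations of `Re f (x k)` for `f` in the dual unit
ball.

First inequality: if every subsequence oscillates by more than `c`, a diagonal argument fixes one
rational pair `r < s` with `s - r > c` and an infinite set of indices all of whose infinite subsets
are split by it. From this one extracts `n i` and `f j` with `Re f j (x (n i)) ≤ r` for `i ≤ j` and
`≥ s` for `j < i` (`HereditarilySplit.exists_seq`). For a cluster point `φ` of `x ∘ n` and a weak*
cluster point `g` of `f`, the two iterated limits disagree: `Re φ (f j) ≥ s` but `Re φ g ≤ r`. An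
element of `X` commutes with the limit in `f`, so it has distance at least `(s - r) / 2` from `φ`
(`half_gap_le_norm_sub`).

L-embedded case: write a cluster point as `y + w` with `w` in the kernel of `P`. A Helly argument
(`IsLOrthogonal.exists_extension`) builds a functional in the unit ball taking values near `‖w‖` and
`-‖w‖` alternately along a subsequence of `x k - y`, so the diameter is at least `2 * ‖w‖`.
Subsequences inherit this, which gives the last inequality. -/

theorem exists_mapClusterPt_toWeakDual {E : Type*} [NormedAddCommGroup E] [NormedSpace 𝕜 E]
    (f : ℕ → StrongDual 𝕜 E) {C : ℝ} (hf : ∀ k, ‖f k‖ ≤ C) :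
    ∃ g : StrongDual 𝕜 E, ‖g‖ ≤ C ∧
      MapClusterPt (StrongDual.toWeakDual g) atTop (fun k => StrongDual.toWeakDual (f k)) := by
  have hc := WeakDual.isCompact_closedBall (𝕜 := 𝕜) (E := E) 0 C
  obtain ⟨u, hu, hcl⟩ := hc.exists_mapClusterPt (f := (atTop : Filter ℕ))
    (u := fun k => StrongDual.toWeakDual (f k)) (by
      rw [le_principal_iff]
      refine mem_map.2 (Eventually.of_forall fun k => ?_)
      simpa using hf k)
  exact ⟨WeakDual.toStrongDual u, by simpa using hu, hcl⟩

theorem mapClusterPt_apply {E : Type*} [NormedAddCommGroup E] [NormedSpace 𝕜 E]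
    {f : ℕ → StrongDual 𝕜 E} {g : StrongDual 𝕜 E}
    (h : MapClusterPt (StrongDual.toWeakDual g) atTop (fun k => StrongDual.toWeakDual (f k)))
    (e : E) : MapClusterPt (g e) atTop (fun k => f k e) :=
  MapClusterPt.continuousAt_comp (f := fun u : WeakDual 𝕜 E => u e)
    (WeakDual.eval_continuous e).continuousAt h

theorem StrongDual.dist_eq_norm_sub {E : Type*} [NormedAddCommGroup E] [NormedSpace 𝕜 E]
    (φ ψ : StrongDual 𝕜 E) : dist φ ψ = ‖φ - ψ‖ :=
  dist_eq_norm φ ψ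

theorem MapClusterPt.mem_of_eventually {α : Type*} [TopologicalSpace α] {u : ℕ → α} {a : α}
    (h : MapClusterPt a atTop u) {S : Set α} (hS : IsClosed S) (hu : ∀ᶠ k in atTop, u k ∈ S) :
    a ∈ S := by
  by_contra ha
  obtain ⟨k, hk, hk'⟩ := ((h.frequently (hS.isOpen_compl.mem_nhds ha)).and_eventually hu).exists
  exact hk hk'

theorem mapClusterPt_of_mem_clust {x : ℕ → X} {φ : StrongDual 𝕜 (StrongDual 𝕜 X)}
    (h : φ ∈ clust 𝕜 x) (f : StrongDual 𝕜 X) : MapClusterPt (φ f) atTop (fun k => f (x k)) :=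
  mapClusterPt_apply (f := fun k => NormedSpace.inclusionInDoubleDual 𝕜 X (x k)) h f

theorem clust_nonempty {x : ℕ → X} {C : ℝ} (hx : ∀ k, ‖x k‖ ≤ C) : (clust 𝕜 x).Nonempty := by
  obtain ⟨g, -, hg⟩ := exists_mapClusterPt_toWeakDual (𝕜 := 𝕜)
    (fun k => NormedSpace.inclusionInDoubleDual 𝕜 X (x k)) (C := C)
    (fun k => (NormedSpace.double_dual_bound 𝕜 X (x k)).trans (hx k))
  exact ⟨g, hg⟩

theorem norm_le_of_mem_clust {x : ℕ → X} {C : ℝ} (hx : ∀ k, ‖x k‖ ≤ C)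
    {φ : StrongDual 𝕜 (StrongDual 𝕜 X)} (h : φ ∈ clust 𝕜 x) : ‖φ‖ ≤ C := by
  have hC : 0 ≤ C := (norm_nonneg _).trans (hx 0)
  refine φ.opNorm_le_bound hC fun f => ?_
  have := (mapClusterPt_of_mem_clust h f).mem_of_eventually
    (S := Metric.closedBall 0 (C * ‖f‖)) Metric.isClosed_closedBall
    (Eventually.of_forall fun k => by
      rw [mem_closedBall_zero_iff, mul_comm]
      exact f.le_opNorm_of_le (hx k))
  simpa using this

theorem isBounded_clust {x : ℕ → X} {C : ℝ} (hx : ∀ k, ‖x k‖ ≤ C) :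
    Bornology.IsBounded (clust 𝕜 x) :=
  isBounded_iff_forall_norm_le.2 ⟨C, fun _ h => norm_le_of_mem_clust hx h⟩

theorem clust_comp_subset (x : ℕ → X) {σ : ℕ → ℕ} (hσ : StrictMono σ) :
    clust 𝕜 (x ∘ σ) ⊆ clust 𝕜 x := fun _ h =>
  MapClusterPt.of_comp hσ.tendsto_atTop h

theorem exists_mem_clust_re_ge {x : ℕ → X} {C : ℝ} (hx : ∀ k, ‖x k‖ ≤ C)
    {f : StrongDual 𝕜 X} {a : ℝ} (h : ∃ᶠ k in atTop, a ≤ RCLike.re (f (x k))) :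
    ∃ φ ∈ clust 𝕜 x, a ≤ RCLike.re (φ f) := by
  obtain ⟨σ, hσ, hσa⟩ := extraction_of_frequently_atTop h
  obtain ⟨φ, hφ⟩ := clust_nonempty (𝕜 := 𝕜) (x := x ∘ σ) (fun k => hx (σ k))
  refine ⟨φ, clust_comp_subset x hσ hφ, ?_⟩
  exact (mapClusterPt_of_mem_clust hφ f).mem_of_eventually
    (S := {z | a ≤ RCLike.re z}) (isClosed_le continuous_const RCLike.continuous_re)
    (Eventually.of_forall hσa)

theorem sub_le_delta {x : ℕ → X} {C : ℝ} (hx : ∀ k, ‖x k‖ ≤ C)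
    {f : StrongDual 𝕜 X} (hf : ‖f‖ ≤ 1) {a b : ℝ}
    (ha : ∃ᶠ k in atTop, a ≤ RCLike.re (f (x k)))
    (hb : ∃ᶠ k in atTop, RCLike.re (f (x k)) ≤ b) : a - b ≤ delta 𝕜 x := by
  obtain ⟨φ, hφ, hφa⟩ := exists_mem_clust_re_ge hx ha
  obtain ⟨ψ, hψ, hψb⟩ := exists_mem_clust_re_ge (f := -f) (a := -b) hx
    (hb.mono fun k hk => by simpa using hk)
  have h1 : RCLike.re ((φ - ψ) f) ≤ ‖φ - ψ‖ :=
    (RCLike.re_le_norm _).trans ((φ - ψ).unit_le_opNorm f hf)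
  have h2 := Metric.dist_le_diam_of_mem (isBounded_clust (𝕜 := 𝕜) hx) hφ hψ
  rw [StrongDual.dist_eq_norm_sub] at h2
  simp only [map_neg] at hψb
  simp only [sub_apply, map_sub] at h1
  unfold delta
  linarith

theorem norm_apply_le_of_norm_le_one {E : Type*} [NormedAddCommGroup E] [NormedSpace 𝕜 E]
    {f : StrongDual 𝕜 E} (hf : ‖f‖ ≤ 1) (e : E) : ‖f e‖ ≤ ‖e‖ := by
  simpa using f.le_of_opNorm_le hf e

theorem exists_re_gt_of_lt_norm {E : Type*} [NormedAddCommGroup E] [NormedSpace 𝕜 E]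
    {φ : StrongDual 𝕜 E} {c : ℝ} (hc : c < ‖φ‖) :
    ∃ f : E, ‖f‖ ≤ 1 ∧ c < RCLike.re (φ f) := by
  rcases lt_or_ge c 0 with h0 | h0
  · exact ⟨0, by simp, by simpa using h0⟩
  obtain ⟨f, hf, hcf⟩ := ContinuousLinearMap.exists_lt_apply_of_lt_opNorm φ hc
  obtain ⟨z, hz, hzf⟩ := RCLike.exists_norm_eq_mul_self (φ f)
  refine ⟨z • f, by rw [norm_smul, hz, one_mul]; exact hf.le, ?_⟩
  rw [map_smul, smul_eq_mul, ← hzf]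
  simpa using hcf

/-- Converse of `sub_le_delta`. The thresholds are rational so that only countably many pairs have
to be diagonalized over. -/
theorem exists_oscillation_of_lt_delta {x : ℕ → X} {c : ℝ} (hc : 0 ≤ c) (h : c < delta 𝕜 x) :
    ∃ (q : ℚ × ℚ) (f : StrongDual 𝕜 X), ‖f‖ ≤ 1 ∧ c < q.2 - q.1 ∧
      (∃ᶠ k in atTop, RCLike.re (f (x k)) ≤ q.1) ∧
      (∃ᶠ k in atTop, q.2 ≤ RCLike.re (f (x k))) := by
  have : ∃ φ ∈ clust 𝕜 x, ∃ ψ ∈ clust 𝕜 x, c < dist φ ψ := by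
    by_contra! hcon
    exact absurd (Metric.diam_le_of_forall_dist_le hc hcon) (not_le.2 h)
  obtain ⟨φ, hφ, ψ, hψ, hd⟩ := this
  replace hd : c < ‖φ - ψ‖ := hd.trans_eq (StrongDual.dist_eq_norm_sub φ ψ)
  obtain ⟨f, hf, hcf⟩ := exists_re_gt_of_lt_norm hd
  simp only [sub_apply, map_sub] at hcf
  set ε := (RCLike.re (φ f) - RCLike.re (ψ f) - c) / 2 with hε
  obtain ⟨s, hs1, hs2⟩ := exists_rat_btwn (show RCLike.re (φ f) - ε < RCLike.re (φ f) by linarith)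
  obtain ⟨r, hr1, hr2⟩ := exists_rat_btwn (show RCLike.re (ψ f) < RCLike.re (ψ f) + ε by linarith)
  refine ⟨(r, s), f, hf, by simp only; linarith, ?_, ?_⟩
  · have := (mapClusterPt_of_mem_clust hψ f).frequently
      ((isOpen_lt RCLike.continuous_re continuous_const).mem_nhds hr1)
    exact this.mono fun k hk => le_of_lt hk
  · have := (mapClusterPt_of_mem_clust hφ f).frequently
      ((isOpen_lt continuous_const RCLike.continuous_re).mem_nhds hs2)
    exact this.mono fun k hk => le_of_lt hk

end Clust

/-! ### Infinite combinatorics: diagonal subsequences and splitting -/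

section Diagonal

/-- Shrink `M` successively to satisfy each `P i`, then take an infinite set almost contained in
every stage; `mono` ignores the finitely many exceptions. -/
theorem exists_infinite_subset_forall {P : ℕ → Set ℕ → Prop} {M : Set ℕ} (hM : M.Infinite)
    (mono : ∀ i A B, P i A → (B \ A).Finite → P i B)
    (dense : ∀ i, ∀ A ⊆ M, A.Infinite → ∃ B ⊆ A, B.Infinite ∧ P i B) :
    ∃ N ⊆ M, N.Infinite ∧ ∀ i, P i N := by
  choose! next hsub hinf hP using dense
  let A : ℕ → Set ℕ := fun n => Nat.rec M (fun i S => next i S) n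
  have hA : ∀ n, A n ⊆ M ∧ (A n).Infinite := fun n => by
    induction n with
    | zero => exact ⟨subset_rfl, hM⟩
    | succ n ih => exact ⟨(hsub n _ ih.1 ih.2).trans ih.1, hinf n _ ih.1 ih.2⟩
  have hanti : Antitone A := antitone_nat_of_succ_le fun n => hsub n _ (hA n).1 (hA n).2
  obtain ⟨φ, hφ, hφA⟩ := extraction_forall_of_frequently
    (P := fun n k => k ∈ A (n + 1)) fun n => Nat.frequently_atTop_iff_infinite.2 (hA (n + 1)).2
  refine ⟨Set.range φ, ?_, Set.infinite_range_of_injective hφ.injective, fun i => ?_⟩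
  · rintro _ ⟨n, rfl⟩
    exact (hA (n + 1)).1 (hφA n)
  · refine mono i (A (i + 1)) _ (hP i _ (hA i).1 (hA i).2)
      (((Set.finite_lt_nat i).image φ).subset ?_)
    rintro _ ⟨⟨n, rfl⟩, hn⟩
    refine ⟨n, ?_, rfl⟩
    by_contra hni
    exact hn (hanti (Nat.succ_le_succ (not_lt.1 hni)) (hφA n))

/-- `lo n f` holds for all `n ∈ F`, and both `lo n f` and `hi n f` hold infinitely often in `M`. -/
def Splits {T : Type*} (lo hi : ℕ → T → Prop) (F : Set ℕ) (f : T) (M : Set ℕ) : Prop :=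
  (∀ n ∈ F, lo n f) ∧ {n ∈ M | lo n f}.Infinite ∧ {n ∈ M | hi n f}.Infinite

variable {T : Type*} {lo hi : ℕ → T → Prop}

theorem infinite_sep_of_diff_finite {p : ℕ → Prop} {M M' : Set ℕ} (h : (M' \ M).Finite)
    (hp : {n ∈ M' | p n}.Infinite) : {n ∈ M | p n}.Infinite := fun hfin =>
  hp ((hfin.union h).subset fun n hn => by
    by_cases hM : n ∈ M
    · exact Or.inl ⟨hM, hn.2⟩
    · exact Or.inr ⟨hn.1, hM⟩)

theorem Splits.mono_almost {F : Set ℕ} {f : T} {M M' : Set ℕ} (h : (M' \ M).Finite)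
    (hf : Splits lo hi F f M') : Splits lo hi F f M :=
  ⟨hf.1, infinite_sep_of_diff_finite h hf.2.1, infinite_sep_of_diff_finite h hf.2.2⟩

/-- Every infinite subset of `M` is split by an `f` with `lo n f` for all `n ∈ F`. -/
def HereditarilySplit (lo hi : ℕ → T → Prop) (F M : Set ℕ) : Prop :=
  ∀ M' ⊆ M, M'.Infinite → ∃ f, Splits lo hi F f M'

/-- If every `n` failed, diagonalizing would give one infinite `N` that no `f` splits with `insert n
F`, for any `n > m` in `M`. But an `f` splitting `N` relative to `F` satisfies `lo` infinitely often
in `N`, so some such `n` can be added. -/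
theorem HereditarilySplit.exists_insert {F M : Set ℕ} (hM : M.Infinite)
    (h : HereditarilySplit lo hi F M) (m : ℕ) :
    ∃ n ∈ M, m < n ∧ ∃ M' ⊆ M, M'.Infinite ∧ HereditarilySplit lo hi (insert n F) M' := by
  by_contra! hcon
  obtain ⟨N, hNM, hN, hP⟩ := exists_infinite_subset_forall hM
    (P := fun n A => n ∈ M → m < n → ∀ f, ¬ Splits lo hi (insert n F) f A)
    (fun i A B hA hBA hi hm f hf => hA hi hm f (hf.mono_almost hBA))
    (fun n A hAM hA => by
      by_cases hn : n ∈ M ∧ m < n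
      · have := hcon n hn.1 hn.2 A hAM hA
        simp only [HereditarilySplit, not_forall, not_exists] at this
        obtain ⟨B, hBA, hB, hf⟩ := this
        exact ⟨B, hBA, hB, fun _ _ => hf⟩
      · exact ⟨A, subset_rfl, hA, fun h1 h2 => absurd ⟨h1, h2⟩ hn⟩)
  obtain ⟨f, hF, hlo, hhi⟩ := h N hNM hN
  obtain ⟨n, hn, hmn⟩ := hlo.exists_gt m
  refine hP n (hNM hn.1) hmn f ⟨fun k hk => ?_, hlo, hhi⟩
  rcases hk with rfl | hk
  · exact hn.2
  · exact hF k hk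

/-- If every infinite set is split, there are `n 0 < n 1 < ⋯` and `f 0, f 1, …` such that
`lo (n i) (f j)` for `i ≤ j` and `hi (n i) (f j)` for `j < i`. -/
theorem HereditarilySplit.exists_seq {M : Set ℕ} (hM : M.Infinite)
    (h : HereditarilySplit lo hi ∅ M) :
    ∃ (n : ℕ → ℕ) (f : ℕ → T), StrictMono n ∧ (∀ i, n i ∈ M) ∧
      (∀ i j, i ≤ j → lo (n i) (f j)) ∧ ∀ i j, j < i → hi (n i) (f j) := by
  -- A state holds the indices chosen so far, the reservoir for later ones, and the last index.
  let S := {p : Set ℕ × Set ℕ × ℕ // p.2.1 ⊆ M ∧ p.2.1.Infinite ∧ HereditarilySplit lo hi p.1 p.2.1}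
  have step : ∀ p : S, ∃ q : S, q.1.2.2 ∈ p.1.2.1 ∧ p.1.2.2 < q.1.2.2 ∧
      q.1.1 = insert q.1.2.2 p.1.1 ∧ q.1.2.1 ⊆ p.1.2.1 ∧
      ∃ f, (∀ k ∈ q.1.1, lo k f) ∧ ∀ k ∈ q.1.2.1, hi k f := by
    rintro ⟨⟨F, A, m⟩, hAM, hA, hF⟩
    obtain ⟨n, hnA, hmn, B, hBA, hB, hn⟩ := hF.exists_insert hA m
    obtain ⟨f, hf⟩ := hn B subset_rfl hB
    -- Cutting the reservoir down to `hi k f` makes every later index satisfy `hi` for this `f`.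
    exact ⟨⟨⟨insert n F, {k ∈ B | hi k f}, n⟩, fun k hk => hAM (hBA hk.1), hf.2.2,
      fun C hC hC' => hn C (fun k hk => (hC hk).1) hC'⟩, hnA, hmn, rfl, fun k hk => hBA hk.1,
      f, hf.1, fun k hk => hk.2⟩
  choose next hmem hlt hins hsub f hlo hhi using step
  let p : ℕ → S := fun j => Nat.rec ⟨⟨∅, M, 0⟩, subset_rfl, hM, h⟩ (fun _ q => next q) j
  have hanti : Antitone fun j => (p j).1.2.1 := antitone_nat_of_succ_le fun j => hsub (p j)
  have hmono : Monotone fun j => (p j).1.1 := monotone_nat_of_le_succ fun j => by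
    change (p j).1.1 ⊆ (next (p j)).1.1
    rw [hins]
    exact Set.subset_insert _ _
  have hin : ∀ i, (p (i + 1)).1.2.2 ∈ (p (i + 1)).1.1 := fun i => by
    change (next (p i)).1.2.2 ∈ (next (p i)).1.1
    rw [hins]
    exact Set.mem_insert _ _
  refine ⟨fun i => (p (i + 1)).1.2.2, fun j => f (p j),
    strictMono_nat_of_lt_succ fun i => hlt (p (i + 1)), fun i => (p i).2.1 (hmem (p i)),
    fun i j hij => hlo (p j) _ (hmono (Nat.succ_le_succ hij) (hin i)),
    fun i j hij => hhi (p j) _ (hanti (Nat.succ_le_of_lt hij) (hmem (p i)))⟩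

theorem exists_hereditarilySplit {Q : Type*} [Countable Q] [Nonempty Q] {lo hi : Q → ℕ → T → Prop}
    (h : ∀ M : Set ℕ, M.Infinite → ∃ q f, Splits (lo q) (hi q) ∅ f M) :
    ∃ q, ∃ M : Set ℕ, M.Infinite ∧ HereditarilySplit (lo q) (hi q) ∅ M := by
  by_contra! hcon
  obtain ⟨e, he⟩ := exists_surjective_nat Q
  obtain ⟨N, -, hN, hP⟩ := exists_infinite_subset_forall Set.infinite_univ
    (P := fun i A => ∀ f, ¬ Splits (lo (e i)) (hi (e i)) ∅ f A)
    (fun i A B hA hBA f hf => hA f (hf.mono_almost hBA))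
    (fun i A _ hA => by
      have := hcon (e i) A hA
      simpa only [HereditarilySplit, not_forall, not_exists, exists_prop] using this)
  obtain ⟨q, f, hf⟩ := h N hN
  obtain ⟨i, rfl⟩ := he q
  exact hP i f hf

end Diagonal

/-! ### The upper bound for `deltaTilde` in an arbitrary space -/

section GeneralBound

variable {𝕜 : Type*} [RCLike 𝕜] {X : Type*} [NormedAddCommGroup X] [NormedSpace 𝕜 X]

theorem deltaTilde_le_delta (x : ℕ → X) {σ : ℕ → ℕ} (hσ : StrictMono σ) :
    deltaTilde 𝕜 x ≤ delta 𝕜 (x ∘ σ) :=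
  csInf_le ⟨0, by rintro _ ⟨_, _, rfl⟩; exact Metric.diam_nonneg⟩ ⟨σ, hσ, rfl⟩

theorem le_deltaTilde {x : ℕ → X} {c : ℝ} (h : ∀ σ : ℕ → ℕ, StrictMono σ → c ≤ delta 𝕜 (x ∘ σ)) :
    c ≤ deltaTilde 𝕜 x :=
  le_csInf ⟨_, id, strictMono_id, rfl⟩ (by rintro _ ⟨σ, hσ, rfl⟩; exact h σ hσ)

theorem canonicalCopy_nonempty : (canonicalCopy 𝕜 X).Nonempty := Set.range_nonempty _

theorem infDist_le_hausdorffExcess {x : ℕ → X} {C : ℝ} (hx : ∀ k, ‖x k‖ ≤ C)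
    {φ : StrongDual 𝕜 (StrongDual 𝕜 X)} (hφ : φ ∈ clust 𝕜 x) :
    Metric.infDist φ (canonicalCopy 𝕜 X) ≤ hausdorffExcess (clust 𝕜 x) (canonicalCopy 𝕜 X) := by
  refine le_csSup ⟨C, ?_⟩ ⟨φ, hφ, rfl⟩
  rintro _ ⟨ψ, hψ, rfl⟩
  have h0 : (0 : StrongDual 𝕜 (StrongDual 𝕜 X)) ∈ canonicalCopy 𝕜 X := ⟨0, map_zero _⟩
  refine (Metric.infDist_le_dist_of_mem h0).trans ?_
  exact (dist_zero_right ψ).trans_le (norm_le_of_mem_clust hx hψ)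

theorem half_gap_le_norm_sub {x : ℕ → X} {n : ℕ → ℕ}
    {f : ℕ → StrongDual 𝕜 X} (hf : ∀ j, ‖f j‖ ≤ 1) {r s : ℝ}
    (hlo : ∀ i j, i ≤ j → RCLike.re (f j (x (n i))) ≤ r)
    (hhi : ∀ i j, j < i → s ≤ RCLike.re (f j (x (n i))))
    {φ : StrongDual 𝕜 (StrongDual 𝕜 X)} (hφ : φ ∈ clust 𝕜 (x ∘ n)) (y : X) :
    (s - r) / 2 ≤ ‖φ - NormedSpace.inclusionInDoubleDual 𝕜 X y‖ := by
  set c := ‖φ - NormedSpace.inclusionInDoubleDual 𝕜 X y‖ with hc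
  have key : ∀ g : StrongDual 𝕜 X, ‖g‖ ≤ 1 → |RCLike.re (φ g) - RCLike.re (g y)| ≤ c := by
    intro g hg
    have h1 := (φ - NormedSpace.inclusionInDoubleDual 𝕜 X y).unit_le_opNorm g hg
    have h2 := RCLike.abs_re_le_norm ((φ - NormedSpace.inclusionInDoubleDual 𝕜 X y) g)
    simp only [sub_apply, map_sub, NormedSpace.dual_def] at h1 h2
    exact h2.trans h1
  have hφf : ∀ j, s ≤ RCLike.re (φ (f j)) := fun j =>
    (mapClusterPt_of_mem_clust hφ (f j)).mem_of_eventually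
      (S := {z | s ≤ RCLike.re z}) (isClosed_le continuous_const RCLike.continuous_re)
      ((eventually_gt_atTop j).mono fun i hi => hhi i j hi)
  obtain ⟨g, hg, hgcl⟩ := exists_mapClusterPt_toWeakDual f hf
  have hgx : ∀ i, RCLike.re (g (x (n i))) ≤ r := fun i =>
    (mapClusterPt_apply hgcl (x (n i))).mem_of_eventually
      (S := {z | RCLike.re z ≤ r}) (isClosed_le RCLike.continuous_re continuous_const)
      ((eventually_ge_atTop i).mono fun j hj => hlo i j hj)
  have hφg : RCLike.re (φ g) ≤ r :=
    (mapClusterPt_of_mem_clust hφ g).mem_of_eventually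
      (S := {z | RCLike.re z ≤ r}) (isClosed_le RCLike.continuous_re continuous_const)
      (Eventually.of_forall hgx)
  -- Evaluation at `y` is weak* continuous, so the lower bound for `f j y` passes to `g`; this fails
  -- for `φ`.
  have hgy : s - c ≤ RCLike.re (g y) :=
    (mapClusterPt_apply hgcl y).mem_of_eventually
      (S := {z | s - c ≤ RCLike.re z}) (isClosed_le continuous_const RCLike.continuous_re)
      (Eventually.of_forall fun j => by
        have h1 := (abs_le.1 (key (f j) (hf j))).2
        have h2 := hφf j
        change s - c ≤ RCLike.re (f j y)
        linarith)
  have := (abs_le.1 (key g hg)).1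
  linarith

theorem deltaTilde_le_two_mul_hausdorffExcess {x : ℕ → X} {C : ℝ} (hx : ∀ k, ‖x k‖ ≤ C) :
    deltaTilde 𝕜 x ≤ 2 * hausdorffExcess (clust 𝕜 x) (canonicalCopy 𝕜 X) := by
  obtain ⟨φ₀, hφ₀⟩ := clust_nonempty (𝕜 := 𝕜) hx
  have h0 := Metric.infDist_nonneg.trans (infDist_le_hausdorffExcess hx hφ₀)
  refine le_of_forall_gt_imp_ge_of_dense fun c hc => ?_
  by_contra! hcd
  let Q := {q : ℚ × ℚ // c < q.2 - q.1}
  let T := {f : StrongDual 𝕜 X // ‖f‖ ≤ 1}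
  let lo : Q → ℕ → T → Prop := fun q n f => RCLike.re (f.1 (x n)) ≤ q.1.1
  let hi : Q → ℕ → T → Prop := fun q n f => q.1.2 ≤ RCLike.re (f.1 (x n))
  have hsplit : ∀ M : Set ℕ, M.Infinite → ∃ q f, Splits (lo q) (hi q) ∅ f M := by
    intro M hM
    obtain ⟨σ, hσ, hσM⟩ := extraction_of_frequently_atTop (Nat.frequently_atTop_iff_infinite.2 hM)
    obtain ⟨q, f, hf, hq, hl, hh⟩ := exists_oscillation_of_lt_delta (𝕜 := 𝕜) (by linarith)
      (hcd.trans_le (deltaTilde_le_delta (𝕜 := 𝕜) x hσ))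
    refine ⟨⟨q, hq⟩, ⟨f, hf⟩, by simp, ?_, ?_⟩
    · refine ((Nat.frequently_atTop_iff_infinite.1 hl).image hσ.injective.injOn).mono ?_
      rintro _ ⟨k, hk, rfl⟩
      exact ⟨hσM k, hk⟩
    · refine ((Nat.frequently_atTop_iff_infinite.1 hh).image hσ.injective.injOn).mono ?_
      rintro _ ⟨k, hk, rfl⟩
      exact ⟨hσM k, hk⟩
  have : Nonempty Q := (hsplit Set.univ Set.infinite_univ).nonempty
  obtain ⟨q, M, hM, hS⟩ := exists_hereditarilySplit hsplit
  obtain ⟨n, f, hn, -, hl, hh⟩ := hS.exists_seq hM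
  obtain ⟨φ, hφ⟩ := clust_nonempty (𝕜 := 𝕜) (x := x ∘ n) (fun k => hx (n k))
  have h1 : ((q.1.2 : ℝ) - q.1.1) / 2 ≤ Metric.infDist φ (canonicalCopy 𝕜 X) := by
    refine (Metric.le_infDist canonicalCopy_nonempty).2 ?_
    rintro _ ⟨y, rfl⟩
    exact (half_gap_le_norm_sub (fun j => (f j).2) hl hh hφ y).trans_eq 
      (StrongDual.dist_eq_norm_sub _ _).symm
  have h2 := infDist_le_hausdorffExcess hx (clust_comp_subset x hn hφ)
  have h3 := q.2
  linarith

end GeneralBound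

/-! ### Lower bounds in L-embedded spaces -/

section LEmbedded

variable {𝕜 : Type*} [RCLike 𝕜]

/-- A real version of Helly's lemma: finitely many functionals can be approximately prescribed on
the unit ball as soon as the dual norm inequality holds. -/
theorem exists_norm_le_one_abs_re_sub_lt {E ι : Type*} [NormedAddCommGroup E] [NormedSpace 𝕜 E]
    [Fintype ι] (φ : ι → StrongDual 𝕜 E) (α : ι → ℝ)
    (h : ∀ a : ι → ℝ, ∑ i, a i * α i ≤ ‖∑ i, (a i : 𝕜) • φ i‖) {ε : ℝ} (hε : 0 < ε) :
    ∃ f : E, ‖f‖ ≤ 1 ∧ ∀ i, |RCLike.re (φ i f) - α i| < ε := by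
  classical
  let C : Set (ι → ℝ) := (fun f : E => fun i => RCLike.re (φ i f)) '' {f | ‖f‖ ≤ 1}
  have hC : Convex ℝ C := by
    rintro _ ⟨f, hf, rfl⟩ _ ⟨g, hg, rfl⟩ a b ha hb hab
    refine ⟨(a : 𝕜) • f + (b : 𝕜) • g, ?_, ?_⟩
    · refine (norm_add_le _ _).trans ?_
      rw [norm_smul, norm_smul, RCLike.norm_of_nonneg ha, RCLike.norm_of_nonneg hb, ← hab]
      exact add_le_add (mul_le_of_le_one_right ha hf) (mul_le_of_le_one_right hb hg)
    · ext i
      simp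
  -- Otherwise a hyperplane separates `α` from `C`; its coefficients violate `h`, the supremum over
  -- the ball being a dual norm.
  have hα : α ∈ closure C := by
    by_contra hα
    obtain ⟨l, u, hl, hu⟩ := geometric_hahn_banach_closed_point hC.closure isClosed_closure hα
    have hlv : ∀ v : ι → ℝ, l v = ∑ i, l (Pi.single i 1) * v i := fun v => by
      conv_lhs => rw [pi_eq_sum_univ' v]
      simp [mul_comm]
    have h1 := hu.trans_le ((hlv α).trans_le (h _))
    obtain ⟨f, hf, huf⟩ := exists_re_gt_of_lt_norm h1
    have h2 := hl _ (subset_closure ⟨f, hf, rfl⟩)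
    rw [hlv] at h2
    refine lt_asymm h2 (huf.trans_eq ?_)
    simp
  obtain ⟨_, ⟨f, hf, rfl⟩, hd⟩ := Metric.mem_closure_iff.1 hα ε hε
  refine ⟨f, hf, fun i => ?_⟩
  rw [dist_comm] at hd
  exact (dist_le_pi_dist _ _ i).trans_lt hd

variable {X : Type*} [NormedAddCommGroup X] [NormedSpace 𝕜 X]

/-- `w` in the bidual is `ℓ¹`-orthogonal to the canonical copy of `X`. -/
def IsLOrthogonal (w : StrongDual 𝕜 (StrongDual 𝕜 X)) : Prop :=
  ∀ (y : X) (t : 𝕜), ‖NormedSpace.inclusionInDoubleDual 𝕜 X y + t • w‖ = ‖y‖ + ‖t‖ * ‖w‖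

variable {w : StrongDual 𝕜 (StrongDual 𝕜 X)}

/-- Orthogonality makes the values of `f` on the span of `F` and `s * ‖w‖` at `w` compatible with
norm one, which is the hypothesis of Helly's lemma. Clustering then replaces `w` by some `z n`. -/
theorem IsLOrthogonal.exists_extension (hw : IsLOrthogonal w) {z : ℕ → X}
    (hz : ∀ f : StrongDual 𝕜 X, MapClusterPt (w f) atTop (fun k => f (z k)))
    (F : Finset X) {f : StrongDual 𝕜 X} (hf : ‖f‖ ≤ 1) {s : ℝ} (hs : |s| ≤ 1) {ε : ℝ} (hε : 0 < ε)
    (m : ℕ) : ∃ g : StrongDual 𝕜 X, ‖g‖ ≤ 1 ∧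
      (∀ y ∈ F, |RCLike.re (g y) - RCLike.re (f y)| < ε) ∧
      ∃ n, m < n ∧ |RCLike.re (g (z n)) - s * ‖w‖| < ε := by
  obtain ⟨g, hg, hgα⟩ := exists_norm_le_one_abs_re_sub_lt (𝕜 := 𝕜) (ι := Option F)
    (fun o => o.elim w fun y => NormedSpace.inclusionInDoubleDual 𝕜 X y)
    (fun o => o.elim (s * ‖w‖) fun y => RCLike.re (f y)) (fun a => by
      simp only [Fintype.sum_option, Option.elim_none, Option.elim_some]
      have h1 : ∑ y : F, a (some y) * RCLike.re (f y) =
          RCLike.re (f (∑ y : F, (a (some y) : 𝕜) • (y : X))) := by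
        simp
      have h2 : ∑ y : F, (a (some y) : 𝕜) • NormedSpace.inclusionInDoubleDual 𝕜 X (y : X) =
          NormedSpace.inclusionInDoubleDual 𝕜 X (∑ y : F, (a (some y) : 𝕜) • (y : X)) := by
        simp
      rw [h1, h2, add_comm (_ • w), hw, add_comm]
      refine add_le_add ((RCLike.re_le_norm _).trans (norm_apply_le_of_norm_le_one hf _)) ?_
      rw [← mul_assoc, RCLike.norm_ofReal]
      refine mul_le_mul_of_nonneg_right ((le_abs_self _).trans ?_) (norm_nonneg w)
      rw [abs_mul]
      exact mul_le_of_le_one_right (abs_nonneg _) hs) hε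
  refine ⟨g, hg, fun y hy => hgα (some ⟨y, hy⟩), ?_⟩
  have hopen : IsOpen {c : 𝕜 | |RCLike.re c - s * ‖w‖| < ε} :=
    isOpen_lt (RCLike.continuous_re.sub continuous_const).abs continuous_const
  obtain ⟨n, hn, hm⟩ := (((hz g).frequently (hopen.mem_nhds (hgα none))).and_eventually
    (eventually_gt_atTop m)).exists
  exact ⟨n, hm, hn⟩

theorem IsLOrthogonal.exists_alternating (hw : IsLOrthogonal w) {z : ℕ → X}
    (hz : ∀ f : StrongDual 𝕜 X, MapClusterPt (w f) atTop (fun k => f (z k)))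
    {ε : ℝ} (hε : 0 < ε) :
    ∃ (f : StrongDual 𝕜 X) (n : ℕ → ℕ), ‖f‖ ≤ 1 ∧ StrictMono n ∧
      ∀ i, |RCLike.re (f (z (n i))) - (-1) ^ i * ‖w‖| ≤ ε := by
  classical
  let S := {p : Finset X × StrongDual 𝕜 X × ℕ // ‖p.2.1‖ ≤ 1}
  have step : ∀ (j : ℕ) (p : S), ∃ q : S, p.1.2.2 < q.1.2.2 ∧
      q.1.1 = insert (z q.1.2.2) p.1.1 ∧
      -- The errors `ε / 2 ^ (j + 1)` sum to `ε`, so earlier values survive in the limit functional.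
      (∀ y ∈ p.1.1, |RCLike.re (q.1.2.1 y) - RCLike.re (p.1.2.1 y)| < ε / 2 ^ (j + 1)) ∧
      |RCLike.re (q.1.2.1 (z q.1.2.2)) - (-1) ^ j * ‖w‖| < ε / 2 ^ (j + 1) := by
    rintro j ⟨⟨F, f, m⟩, hf⟩
    obtain ⟨g, hg, hgF, n, hmn, hn⟩ := hw.exists_extension hz F hf (s := (-1) ^ j) (by simp)
      (show 0 < ε / 2 ^ (j + 1) by positivity) m
    exact ⟨⟨⟨insert (z n) F, g, n⟩, hg⟩, hmn, rfl, hgF, hn⟩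
  choose next hlt hins hF hnew using step
  let p : ℕ → S := fun j => Nat.rec ⟨⟨∅, 0, 0⟩, by simp⟩ next j
  have hmono : Monotone fun j => (p j).1.1 := monotone_nat_of_le_succ fun j => by
    change (p j).1.1 ⊆ (next j (p j)).1.1
    rw [hins]
    exact Finset.subset_insert _ _
  have hin : ∀ i, z (p (i + 1)).1.2.2 ∈ (p (i + 1)).1.1 := fun i => by
    change z (next i (p i)).1.2.2 ∈ (next i (p i)).1.1
    rw [hins]
    exact Finset.mem_insert_self _ _
  have hbound : ∀ i j, i ≤ j → |RCLike.re ((p (j + 1)).1.2.1 (z (p (i + 1)).1.2.2)) -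
      (-1) ^ i * ‖w‖| ≤ ε * (1 - 1 / 2 ^ (j + 1)) := by
    intro i j hij
    induction j, hij using Nat.le_induction with
    | base =>
      refine (hnew i (p i)).le.trans ?_
      have : (1 : ℝ) / 2 ^ (i + 1) ≤ 1 / 2 := by
        rw [pow_succ]
        exact one_div_le_one_div_of_le two_pos (by linarith [one_le_pow₀ (one_le_two (α := ℝ)) (n := i)])
      rw [div_eq_mul_one_div]
      exact mul_le_mul_of_nonneg_left (by linarith) hε.le
    | succ j hij ih =>
      have h1 := hF (j + 1) (p (j + 1)) _ (hmono (Nat.succ_le_succ hij) (hin i))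
      refine (abs_sub_le _ _ _).trans ((add_le_add h1.le ih).trans_eq ?_)
      field_simp
      ring
  obtain ⟨g, hg, hgcl⟩ := exists_mapClusterPt_toWeakDual (fun j => (p (j + 1)).1.2.1)
    (fun j => (p (j + 1)).2)
  refine ⟨g, fun i => (p (i + 1)).1.2.2, hg,
    strictMono_nat_of_lt_succ fun i => hlt (i + 1) (p (i + 1)), fun i => ?_⟩
  refine (mapClusterPt_apply hgcl (z (p (i + 1)).1.2.2)).mem_of_eventually
    (S := {c | |RCLike.re c - (-1) ^ i * ‖w‖| ≤ ε})
    (isClosed_le (RCLike.continuous_re.sub continuous_const).abs continuous_const)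
    ((eventually_ge_atTop i).mono fun j hj => (hbound i j hj).trans ?_)
  exact mul_le_of_le_one_right hε.le (by simp)

theorem IsLOrthogonal.two_mul_norm_le_delta (hw : IsLOrthogonal w) {x : ℕ → X} {C : ℝ}
    (hx : ∀ k, ‖x k‖ ≤ C) {y : X}
    (hy : NormedSpace.inclusionInDoubleDual 𝕜 X y + w ∈ clust 𝕜 x) :
    2 * ‖w‖ ≤ delta 𝕜 x := by
  refine le_of_forall_pos_le_add fun ε hε => ?_
  obtain ⟨f, n, hf, hn, hfn⟩ := hw.exists_alternating (z := fun k => x k - y) (fun f => by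
    have := MapClusterPt.continuousAt_comp (f := fun c : 𝕜 => c - f y) (by fun_prop)
      (mapClusterPt_of_mem_clust hy f)
    simpa [Function.comp_def] using this) (half_pos hε)
  have ha : ∃ᶠ k in atTop, RCLike.re (f y) + ‖w‖ - ε / 2 ≤ RCLike.re (f (x k)) := by
    refine frequently_atTop.2 fun a => ⟨n (2 * a), (by omega : a ≤ 2 * a).trans (hn.le_apply), ?_⟩
    have := (abs_le.1 (hfn (2 * a))).1
    simp only [map_sub, pow_mul, neg_one_sq, one_pow, one_mul] at this
    linarith
  have hb : ∃ᶠ k in atTop, RCLike.re (f (x k)) ≤ RCLike.re (f y) - ‖w‖ + ε / 2 := by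
    refine frequently_atTop.2 fun a =>
      ⟨n (2 * a + 1), (by omega : a ≤ 2 * a + 1).trans (hn.le_apply), ?_⟩
    have := (abs_le.1 (hfn (2 * a + 1))).2
    simp only [map_sub, pow_add, pow_mul, neg_one_sq, one_pow, one_mul, pow_one, neg_mul] at this
    linarith
  have := sub_le_delta hx hf ha hb
  linarith

theorem norm_add_smul_sub_of_lProjection {E : Type*} [NormedAddCommGroup E] [NormedSpace 𝕜 E]
    {P : E →ₗ[𝕜] E} (hP : ∀ φ, P (P φ) = P φ) (hnorm : ∀ φ, ‖φ‖ = ‖P φ‖ + ‖φ - P φ‖)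
    {y : E} (hy : P y = y) (φ : E) (t : 𝕜) :
    ‖y + t • (φ - P φ)‖ = ‖y‖ + ‖t‖ * ‖φ - P φ‖ := by
  rw [hnorm]
  simp [hP, hy, norm_smul]

theorem IsLEmbedded.exists_two_mul_dist_le_delta (hX : IsLEmbedded 𝕜 X) {x : ℕ → X} {C : ℝ}
    (hx : ∀ k, ‖x k‖ ≤ C) {φ : StrongDual 𝕜 (StrongDual 𝕜 X)} (hφ : φ ∈ clust 𝕜 x) :
    ∃ a ∈ canonicalCopy 𝕜 X, 2 * dist φ a ≤ delta 𝕜 x := by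
  obtain ⟨P, hP, hrange, hnorm⟩ := hX
  have hPX : ∀ y : X, P (NormedSpace.inclusionInDoubleDual 𝕜 X y) =
      NormedSpace.inclusionInDoubleDual 𝕜 X y := by
    intro y
    have : NormedSpace.inclusionInDoubleDual 𝕜 X y ∈ Set.range P := hrange ▸ ⟨y, rfl⟩
    obtain ⟨ψ, hψ⟩ := this
    rw [← hψ, hP]
  have hPφ : P φ ∈ canonicalCopy 𝕜 X := hrange ▸ ⟨φ, rfl⟩
  refine ⟨P φ, hPφ, ?_⟩
  obtain ⟨y, hy⟩ := hPφ
  have hw : IsLOrthogonal (φ - P φ) := fun v t =>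
    (norm_add_smul_sub_of_lProjection hP hnorm (hPX v) φ t).trans
      (congrArg (· + _) ((NormedSpace.inclusionInDoubleDualLi 𝕜).norm_map v))
  have hsum : P φ + (φ - P φ) = φ := add_sub_cancel (P φ) φ
  have := hw.two_mul_norm_le_delta hx (y := y) (by rwa [hy, hsum])
  rwa [StrongDual.dist_eq_norm_sub]

theorem setDist_le {E : Type*} [PseudoMetricSpace E] {A B : Set E} {a b : E} (ha : a ∈ A)
    (hb : b ∈ B) : setDist A B ≤ dist a b :=
  csInf_le ⟨0, by rintro _ ⟨a, -, b, -, rfl⟩; exact dist_nonneg⟩ ⟨a, ha, b, hb, rfl⟩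

theorem IsLEmbedded.two_mul_hausdorffExcess_le_delta (hX : IsLEmbedded 𝕜 X) {x : ℕ → X} {C : ℝ}
    (hx : ∀ k, ‖x k‖ ≤ C) :
    2 * hausdorffExcess (clust 𝕜 x) (canonicalCopy 𝕜 X) ≤ delta 𝕜 x := by
  have : hausdorffExcess (clust 𝕜 x) (canonicalCopy 𝕜 X) ≤ delta 𝕜 x / 2 := by
    refine csSup_le ((clust_nonempty hx).image _) ?_
    rintro _ ⟨φ, hφ, rfl⟩
    obtain ⟨a, ha, had⟩ := hX.exists_two_mul_dist_le_delta hx hφ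
    have := Metric.infDist_le_dist_of_mem ha (x := φ)
    simp only
    linarith
  linarith

theorem IsLEmbedded.two_mul_setDist_le_deltaTilde (hX : IsLEmbedded 𝕜 X) {x : ℕ → X} {C : ℝ}
    (hx : ∀ k, ‖x k‖ ≤ C) :
    2 * setDist (clust 𝕜 x) (canonicalCopy 𝕜 X) ≤ deltaTilde 𝕜 x := by
  refine le_deltaTilde fun σ hσ => ?_
  have hxσ : ∀ k, ‖(x ∘ σ) k‖ ≤ C := fun k => hx (σ k)
  obtain ⟨φ, hφ⟩ := clust_nonempty (𝕜 := 𝕜) hxσ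
  obtain ⟨a, ha, had⟩ := hX.exists_two_mul_dist_le_delta hxσ hφ
  have := setDist_le (clust_comp_subset x hσ hφ) ha
  linarith

end LEmbedded

/-! ### The space `ℓ¹` and optimality of the factor -/

section EllOne

variable {𝕜 : Type*} [RCLike 𝕜]

theorem lp_one_hasSum_norm (y : lp (fun _ : ℕ => 𝕜) 1) : HasSum (fun n => ‖y n‖) ‖y‖ := by
  simpa using lp.hasSum_norm (p := 1) (by simp) y

/-- The functional on `ℓ¹` given by a sequence in the unit ball of `ℓ^∞`. -/
theorem exists_functional_lp_one (u : ℕ → 𝕜) (hu : ∀ n, ‖u n‖ ≤ 1) :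
    ∃ f : StrongDual 𝕜 (lp (fun _ : ℕ => 𝕜) 1), ‖f‖ ≤ 1 ∧ ∀ n, f (unitVec 𝕜 n) = u n := by
  have hle : ∀ (y : lp (fun _ : ℕ => 𝕜) 1) n, ‖u n * y n‖ ≤ ‖y n‖ := fun y n => by
    rw [norm_mul]
    exact mul_le_of_le_one_left (norm_nonneg _) (hu n)
  have hs : ∀ y : lp (fun _ : ℕ => 𝕜) 1, Summable fun n => u n * y n := fun y =>
    Summable.of_norm_bounded (lp_one_hasSum_norm y).summable (hle y)
  let L : lp (fun _ : ℕ => 𝕜) 1 →ₗ[𝕜] 𝕜 :=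
    { toFun := fun y => ∑' n, u n * y n
      map_add' := fun y z => by
        rw [← (hs y).tsum_add (hs z)]
        simp [mul_add]
      map_smul' := fun c y => by
        rw [RingHom.id_apply, smul_eq_mul, ← tsum_mul_left]
        simp [mul_left_comm] }
  refine ⟨L.mkContinuous 1 fun y => ?_, LinearMap.mkContinuous_norm_le _ zero_le_one _,
    fun n => ?_⟩
  · rw [one_mul]
    exact tsum_of_norm_bounded (lp_one_hasSum_norm y) (hle y)
  · change ∑' k, u k * unitVec 𝕜 n k = u n
    rw [tsum_eq_single n]
    · simp [unitVec, lp.single_apply]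
    · intro k hk
      simp [unitVec, lp.single_apply, hk]

/-- The `n`-th coordinate functional on `ℓ¹`. -/
noncomputable def coord (𝕜 : Type*) [RCLike 𝕜] (n : ℕ) : StrongDual 𝕜 (lp (fun _ : ℕ => 𝕜) 1) :=
  lp.evalCLM 𝕜 (fun _ : ℕ => 𝕜) 1 n

theorem coord_apply (n : ℕ) (y : lp (fun _ : ℕ => 𝕜) 1) : coord 𝕜 n y = y n := rfl

theorem norm_sub_sum_unitVec (y : lp (fun _ : ℕ => 𝕜) 1) (s : Finset ℕ) :
    ‖y - ∑ n ∈ s, y n • unitVec 𝕜 n‖ = ‖y‖ - ∑ n ∈ s, ‖y n‖ := by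
  have := lp.norm_compl_sum_single (p := 1) (by simp) y s
  simp only [ENNReal.toReal_one, Real.rpow_one] at this
  rw [← this]
  congr 3
  ext1 n
  rw [unitVec, ← lp.single_smul]
  simp

/-- Replacing finitely many coordinates of a functional in the unit ball of the dual of `ℓ¹` by
numbers of modulus at most one keeps it in the unit ball. -/
theorem norm_replace_coord_le {g : StrongDual 𝕜 (lp (fun _ : ℕ => 𝕜) 1)} (hg : ‖g‖ ≤ 1)
    {u : ℕ → 𝕜} (hu : ∀ n, ‖u n‖ ≤ 1) (s : Finset ℕ) :
    ‖∑ n ∈ s, u n • coord 𝕜 n + (g - ∑ n ∈ s, g (unitVec 𝕜 n) • coord 𝕜 n)‖ ≤ 1 := by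
  refine ContinuousLinearMap.opNorm_le_bound _ zero_le_one fun y => ?_
  have h1 : (∑ n ∈ s, u n • coord 𝕜 n + (g - ∑ n ∈ s, g (unitVec 𝕜 n) • coord 𝕜 n)) y =
      ∑ n ∈ s, u n * y n + g (y - ∑ n ∈ s, y n • unitVec 𝕜 n) := by
    simp [coord_apply, mul_comm]
  rw [h1, one_mul]
  have h2 : ‖∑ n ∈ s, u n * y n‖ ≤ ∑ n ∈ s, ‖y n‖ := norm_sum_le_of_le _ fun n _ => by
    rw [norm_mul]
    exact mul_le_of_le_one_left (norm_nonneg _) (hu n)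
  have h3 := norm_apply_le_of_norm_le_one hg (y - ∑ n ∈ s, y n • unitVec 𝕜 n)
  rw [norm_sub_sum_unitVec] at h3
  linarith [norm_add_le (∑ n ∈ s, u n * y n) (g (y - ∑ n ∈ s, y n • unitVec 𝕜 n))]

theorem exists_norm_le_one_mul_eq_norm (c : 𝕜) : ∃ u : 𝕜, ‖u‖ ≤ 1 ∧ u * c = (‖c‖ : 𝕜) := by
  obtain ⟨u, hu, h⟩ := RCLike.exists_norm_eq_mul_self c
  exact ⟨u, hu.le, h.symm⟩

theorem sum_norm_apply_coord_le (φ : StrongDual 𝕜 (StrongDual 𝕜 (lp (fun _ : ℕ => 𝕜) 1)))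
    (s : Finset ℕ) : ∑ n ∈ s, ‖φ (coord 𝕜 n)‖ ≤ ‖φ‖ := by
  choose u hu huφ using fun n => exists_norm_le_one_mul_eq_norm (φ (coord 𝕜 n))
  have h := φ.unit_le_opNorm _ (norm_replace_coord_le (g := 0) (by simp) hu s)
  have h2 := (RCLike.re_le_norm _).trans h
  simpa [huφ] using h2

/-- The restriction of a functional on the dual of `ℓ¹` to the coordinate functionals, as an element
of `ℓ¹`. -/
noncomputable def coordRestrict (𝕜 : Type*) [RCLike 𝕜] :
    StrongDual 𝕜 (StrongDual 𝕜 (lp (fun _ : ℕ => 𝕜) 1)) →ₗ[𝕜] lp (fun _ : ℕ => 𝕜) 1 where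
  toFun φ := ⟨fun n => φ (coord 𝕜 n), memℓp_gen' (C := ‖φ‖) fun s => by
    simpa using sum_norm_apply_coord_le φ s⟩
  map_add' _ _ := rfl
  map_smul' _ _ := rfl

theorem coordRestrict_inclusion (y : lp (fun _ : ℕ => 𝕜) 1) :
    coordRestrict 𝕜 (NormedSpace.inclusionInDoubleDual 𝕜 _ y) = y := by
  ext n
  rfl

/-- For `≥`, test `φ` on a functional with the conjugate phases of `y` on a finite set `s` and an
almost norming `g` for `ψ` elsewhere: `ψ` vanishes on coordinates, so it does not see the change. -/
theorem norm_eq_coordRestrict_add (φ : StrongDual 𝕜 (StrongDual 𝕜 (lp (fun _ : ℕ => 𝕜) 1))) :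
    ‖φ‖ = ‖coordRestrict 𝕜 φ‖ +
      ‖φ - NormedSpace.inclusionInDoubleDual 𝕜 _ (coordRestrict 𝕜 φ)‖ := by
  set y := coordRestrict 𝕜 φ with hy
  set ψ := φ - NormedSpace.inclusionInDoubleDual 𝕜 _ y with hψ
  have hφψ : ∀ f, φ f = ψ f + f y := fun f => by simp [hψ]
  have hψc : ∀ n, ψ (coord 𝕜 n) = 0 := fun n => sub_self _
  refine le_antisymm ?_ ?_
  · have h1 : NormedSpace.inclusionInDoubleDual 𝕜 _ y + ψ = φ := add_sub_cancel _ φ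
    have h2 : ‖NormedSpace.inclusionInDoubleDual 𝕜 _ y + ψ‖ ≤
      ‖NormedSpace.inclusionInDoubleDual 𝕜 _ y‖ + ‖ψ‖ := norm_add_le _ ψ
    rw [h1] at h2
    linarith [NormedSpace.double_dual_bound 𝕜 _ y]
  rw [← le_sub_iff_add_le']
  refine le_of_forall_lt_imp_le_of_dense fun c hc => ?_
  obtain ⟨g, hg, hcg⟩ := exists_re_gt_of_lt_norm hc
  choose u hu huφ using fun n => exists_norm_le_one_mul_eq_norm (y n)
  -- One sum is gained from the phases on `s`; the other comes from the tail loss `‖y‖ - ∑ n ∈ s, ‖y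
  -- n‖`.
  have key : ∀ s : Finset ℕ, 2 * ∑ n ∈ s, ‖y n‖ + c - ‖y‖ ≤ ‖φ‖ := by
    intro s
    have h1 := (RCLike.re_le_norm _).trans (φ.unit_le_opNorm _ (norm_replace_coord_le hg hu s))
    have h2 : φ (∑ n ∈ s, u n • coord 𝕜 n + (g - ∑ n ∈ s, g (unitVec 𝕜 n) • coord 𝕜 n)) =
        ∑ n ∈ s, (‖y n‖ : 𝕜) + ψ g + g (y - ∑ n ∈ s, y n • unitVec 𝕜 n) := by
      rw [hφψ]
      simp [hψc, coord_apply, huφ, mul_comm]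
      ring
    have h3 := (RCLike.abs_re_le_norm _).trans
      (norm_apply_le_of_norm_le_one hg (y - ∑ n ∈ s, y n • unitVec 𝕜 n))
    rw [norm_sub_sum_unitVec] at h3
    have h4 := (abs_le.1 h3).1
    rw [h2] at h1
    simp only [map_add, map_sum, RCLike.ofReal_re] at h1
    linarith
  have hlim := (((lp_one_hasSum_norm y).const_mul 2).add_const c).sub_const ‖y‖
  have := le_of_tendsto' hlim key
  linarith

theorem isLEmbedded_lp_one : IsLEmbedded 𝕜 (lp (fun _ : ℕ => 𝕜) 1) := by
  refine ⟨(NormedSpace.inclusionInDoubleDual 𝕜 _).toLinearMap ∘ₗ coordRestrict 𝕜, fun φ => ?_,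
    Set.Subset.antisymm ?_ ?_, fun φ => ?_⟩
  · simp [coordRestrict_inclusion]
  · rintro _ ⟨φ, rfl⟩
    exact ⟨_, rfl⟩
  · rintro _ ⟨y, rfl⟩
    exact ⟨NormedSpace.inclusionInDoubleDual 𝕜 _ y, by simp [coordRestrict_inclusion]⟩
  · refine (norm_eq_coordRestrict_add φ).trans (congrArg₂ _ ?_ rfl)
    exact ((NormedSpace.inclusionInDoubleDualLi 𝕜).norm_map (coordRestrict 𝕜 φ)).symm

theorem norm_unitVec (k : ℕ) : ‖unitVec 𝕜 k‖ = 1 := by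
  rw [unitVec, lp.norm_single (by simp), norm_one]

/-- A cluster point kills all coordinates, yet the summation functional gives it norm at least one;
the L-decomposition then adds `‖y‖` to its norm. -/
theorem one_le_dist_of_mem_clust_unitVec
    {φ a : StrongDual 𝕜 (StrongDual 𝕜 (lp (fun _ : ℕ => 𝕜) 1))} (hφ : φ ∈ clust 𝕜 (unitVec 𝕜))
    (ha : a ∈ canonicalCopy 𝕜 (lp (fun _ : ℕ => 𝕜) 1)) : 1 ≤ dist φ a := by
  obtain ⟨y, rfl⟩ := ha
  have hcoord : coordRestrict 𝕜 φ = 0 := by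
    ext n
    refine (mapClusterPt_of_mem_clust hφ (coord 𝕜 n)).mem_of_eventually (S := {0})
      isClosed_singleton ((eventually_gt_atTop n).mono fun k hk => ?_)
    simp [coord_apply, unitVec, lp.single_apply, hk.ne]
  obtain ⟨f, hf, hfe⟩ := exists_functional_lp_one (fun _ => (1 : 𝕜)) (by simp)
  have hφf : φ f = 1 := (mapClusterPt_of_mem_clust hφ f).mem_of_eventually (S := {1})
    isClosed_singleton (Eventually.of_forall hfe)
  have hφ1 : 1 ≤ ‖φ‖ := by
    have := φ.unit_le_opNorm f hf
    rwa [hφf, norm_one] at this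
  have h1 : coordRestrict 𝕜 (φ - NormedSpace.inclusionInDoubleDual 𝕜 _ y) = -y :=
    ((coordRestrict 𝕜).map_sub φ _).trans (by rw [hcoord, coordRestrict_inclusion, zero_sub])
  have h2 : φ - NormedSpace.inclusionInDoubleDual 𝕜 _ y -
      NormedSpace.inclusionInDoubleDual 𝕜 _ (-y) = φ := by
    ext f
    simp
  rw [StrongDual.dist_eq_norm_sub, norm_eq_coordRestrict_add, h1, h2]
  linarith [norm_nonneg (-y)]

theorem two_le_delta_unitVec_comp {σ : ℕ → ℕ} (hσ : StrictMono σ) :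
    2 ≤ delta 𝕜 (unitVec 𝕜 ∘ σ) := by
  classical
  obtain ⟨f, hf, hfe⟩ := exists_functional_lp_one
    (fun n => if ∃ k, σ (2 * k) = n then (1 : 𝕜) else -1) (fun n => by split_ifs <;> simp)
  have h := sub_le_delta (𝕜 := 𝕜) (x := unitVec 𝕜 ∘ σ) (C := 1) (fun k => (norm_unitVec _).le) hf
    (a := 1) (b := -1)
    (frequently_atTop.2 fun a => ⟨2 * a, by omega, by simp [hfe]⟩)
    (frequently_atTop.2 fun a => ⟨2 * a + 1, by omega, by
      have : ¬ ∃ k, σ (2 * k) = σ (2 * a + 1) := by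
        rintro ⟨k, hk⟩
        have := hσ.injective hk
        omega
      simp [hfe, this]⟩)
  linarith

end EllOne

theorem theorem1 {𝕜 : Type*} [RCLike 𝕜] :
    (∀ (X : Type*) [NormedAddCommGroup X] [NormedSpace 𝕜 X] [CompleteSpace X] (x : ℕ → X),
      Bornology.IsBounded (Set.range x) →
        deltaTilde 𝕜 x ≤ 2 * hausdorffExcess (clust 𝕜 x) (canonicalCopy 𝕜 X) ∧
        (IsLEmbedded 𝕜 X →
          2 * hausdorffExcess (clust 𝕜 x) (canonicalCopy 𝕜 X) ≤ delta 𝕜 x ∧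
          2 * setDist (clust 𝕜 x) (canonicalCopy 𝕜 X) ≤ deltaTilde 𝕜 x)) ∧
    -- the factor `2` is optimal in all three inequalities
    (IsLEmbedded 𝕜 (lp (fun _ : ℕ => 𝕜) 1) ∧
      Bornology.IsBounded (Set.range (unitVec 𝕜)) ∧
      hausdorffExcess (clust 𝕜 (unitVec 𝕜)) (canonicalCopy 𝕜 (lp (fun _ : ℕ => 𝕜) 1)) = 1 ∧
      setDist (clust 𝕜 (unitVec 𝕜)) (canonicalCopy 𝕜 (lp (fun _ : ℕ => 𝕜) 1)) = 1 ∧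
      deltaTilde 𝕜 (unitVec 𝕜) = 2 ∧
      delta 𝕜 (unitVec 𝕜) = 2) := by
  have he : ∀ k, ‖unitVec 𝕜 k‖ ≤ 1 := fun k => (norm_unitVec k).le
  have hL := isLEmbedded_lp_one (𝕜 := 𝕜)
  obtain ⟨φ, hφ⟩ := clust_nonempty (𝕜 := 𝕜) he
  have h1 : 2 ≤ deltaTilde 𝕜 (unitVec 𝕜) := le_deltaTilde fun σ hσ => two_le_delta_unitVec_comp hσ
  have h2 : deltaTilde 𝕜 (unitVec 𝕜) ≤ delta 𝕜 (unitVec 𝕜) :=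
    deltaTilde_le_delta (𝕜 := 𝕜) (unitVec 𝕜) strictMono_id
  have h3 : delta 𝕜 (unitVec 𝕜) ≤ 2 := by
    refine Metric.diam_le_of_forall_dist_le zero_le_two fun ψ hψ χ hχ => ?_
    rw [StrongDual.dist_eq_norm_sub]
    linarith [norm_sub_le ψ χ, norm_le_of_mem_clust he hψ, norm_le_of_mem_clust he hχ]
  -- The chain `2 ≤ deltaTilde ≤ 2 * hausdorffExcess ≤ delta ≤ 2` collapses to equalities.
  have h4 := hL.two_mul_hausdorffExcess_le_delta he
  have h5 := hL.two_mul_setDist_le_deltaTilde he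
  have h6 := deltaTilde_le_two_mul_hausdorffExcess (𝕜 := 𝕜) he
  have h7 : 1 ≤ setDist (clust 𝕜 (unitVec 𝕜)) (canonicalCopy 𝕜 (lp (fun _ : ℕ => 𝕜) 1)) := by
    refine le_csInf (Set.Nonempty.image2 ⟨φ, hφ⟩ canonicalCopy_nonempty) ?_
    rintro _ ⟨ψ, hψ, a, ha, rfl⟩
    exact one_le_dist_of_mem_clust_unitVec hψ ha
  refine ⟨fun X _ _ _ x hx => ?_, hL, ?_, by linarith, by linarith, by linarith, by linarith⟩
  · obtain ⟨C, hC⟩ := isBounded_iff_forall_norm_le.1 hx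
    have hxC : ∀ k, ‖x k‖ ≤ C := fun k => hC _ ⟨k, rfl⟩
    exact ⟨deltaTilde_le_two_mul_hausdorffExcess hxC, fun hX =>
      ⟨hX.two_mul_hausdorffExcess_le_delta hxC, hX.two_mul_setDist_le_deltaTilde hxC⟩⟩
  · exact isBounded_iff_forall_norm_le.2 ⟨1, by rintro _ ⟨k, rfl⟩; exact he k⟩
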